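/- Let $0<\alpha<1$. Let $E_\alpha(x)=\sum_{k\ge 0} x^k/\Gamma(\alpha k+1)$ be the Mittag-Leffler function, which is a strictly increasing bijection from $\mathbb R$ onto $(0,\infty)$, and let $\mathrm{Ln}_\alpha:(0,\infty)\to\mathbb R$ be its inverse; put $0\,[-\mathrm{Ln}_\alpha 0]^{1/\alpha}=0$. For a nonnegative random variable $X$ with distribution function $F_X$ and survival function $\bar F_X=1-F_X$, define the extended fractional cumulative past entropy, the extended fractional cumulative residual entropy and the extended fractional cumulative paired $\phi$-entropy, all with values in $[0,\infty]$, by $$\mathcal E^*_\alpha(X)=\int_0^\infty F_X(x)\,[-\mathrm{Ln}_\alpha F_X(x)]^{1/\alpha}\,dx,\qquad \mathcal E_\alpha(X)=\int_0^\infty \bar F_X(x)\,[-\mathrm{Ln}_\alpha \bar F_X(x)]^{1/\alpha}\,dx,\qquad \mathcal{PE}_\alpha(X)=\mathcal E_\alpha(X)+\mathcal E^*_\alpha(X).$$ Let $X$ and $Y$ be independent nonnegative random variables, each having a log-concave probability density. Then $$\mathcal E^*_\alpha(X+Y)\ \ge\ \max\{\mathcal E^*_\alpha(X),\ \mathcal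 E^*_\alpha(Y)\}\qquad\text{and}\qquad \mathcal{PE}_\alpha(X+Y)\ \ge\ \max\{\mathcal{PE}_\alpha(X),\ \mathcal{PE}_\alpha(Y)\}.$$ -/

import Mathlib

open MeasureTheory ProbabilityTheory Set

noncomputable section

namespace FracEntropy

/-- The Mittag-Leffler function `E_α(x) = ∑_{k ≥ 0} x ^ k / Γ(α k + 1)`. For `α > 0` the series
converges for every real `x`. -/
def mittagLeffler (α x : ℝ) : ℝ :=
  ∑' k : ℕ, x ^ k / Real.Gamma (α * k + 1)

/-- The fractional order logarithm `Ln_α`, the inverse of the Mittag-Leffler function `E_α`.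
For `0 < α < 1` the function `E_α` is a continuous strictly increasing bijection from `ℝ` onto
`(0, ∞)`, so for `u > 0` the set below is the half-line `(-∞, y]` where `y` is the unique real
with `E_α(y) = u`. The value at `0` (where `Ln_α 0 = -∞`) is a placeholder: it is only used
multiplied by `0`, in accordance with the convention `0 · [-Ln_α 0] ^ (1/α) = 0`. -/
def fracLog (α u : ℝ) : ℝ :=
  sSup {y : ℝ | mittagLeffler α y ≤ u}

/-- The integrand `u [-Ln_α u] ^ (1/α)`, for a probability `u ∈ [0, 1]`. -/
def entropyFun (α u : ℝ) : ℝ :=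
  u * (-fracLog α u) ^ (1 / α)

variable {Ω : Type*} [MeasurableSpace Ω]

/-- Extended fractional cumulative past entropy
`∫₀^∞ F(x) [-Ln_α F(x)] ^ (1/α) dx`, with values in `[0, ∞]`, where `F` is the
distribution function of `X`. -/
def efcpe (α : ℝ) (X : Ω → ℝ) (P : Measure Ω) : ENNReal :=
  ∫⁻ x in Ioi (0 : ℝ), ENNReal.ofReal (entropyFun α (cdf (P.map X) x))

/-- Extended fractional cumulative residual entropy
`∫₀^∞ (1 - F(x)) [-Ln_α (1 - F(x))] ^ (1/α) dx`, with values in `[0, ∞]`. -/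
def efcre (α : ℝ) (X : Ω → ℝ) (P : Measure Ω) : ENNReal :=
  ∫⁻ x in Ioi (0 : ℝ), ENNReal.ofReal (entropyFun α (1 - cdf (P.map X) x))

/-- Extended fractional cumulative paired `φ`-entropy: the sum of the residual and the past
entropies. -/
def pairedEntropy (α : ℝ) (X : Ω → ℝ) (P : Measure Ω) : ENNReal :=
  efcre α X P + efcpe α X P

/-- A nonnegative function `f` on the line is log-concave if
`f(a x + b y) ≥ f(x) ^ a f(y) ^ b` whenever `a, b > 0` and `a + b = 1`, that is, if `log f`
(with `log 0 = -∞`) is concave. -/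
def LogConcave (f : ℝ → ℝ) : Prop :=
  (∀ x, 0 ≤ f x) ∧
    ∀ x y a b : ℝ, 0 < a → 0 < b → a + b = 1 → f x ^ a * f y ^ b ≤ f (a * x + b * y)

/-- The law of `X` is absolutely continuous with a log-concave density. -/
def HasLogConcaveDensity (X : Ω → ℝ) (P : Measure Ω) : Prop :=
  ∃ f : ℝ → ℝ, Measurable f ∧ LogConcave f ∧
    P.map X = volume.withDensity (fun x => ENNReal.ofReal (f x))

end FracEntropy

end

/-! Let `F` be the distribution function of `X` with log-concave density `f`, and `G` that of `X +
Y`. Log-concavity gives each `p ↦ F (F⁻¹ p + h)`, `h ≥ 0`, a supporting line (`mul_cdf_sub_le`).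
Averaging it over the law of `Y` shows that quantiles of `X + Y` are spread at least as far apart as
those of `X` (`cdf_conv_add_le`). Hence `F⁻¹ ∘ G` is 1-Lipschitz, and Lebesgue measure pushed to
`(0, 1)` by `F` is at most that pushed by `G` (`volume_preimage_cdf_le`). So `∫ g (F x) dx` grows
for every measurable `g ≥ 0` with `g 0 = g 1 = 0`; both entropies have this form. -/

namespace FracEntropy

/-! ### Mittag-Leffler function: measurability and endpoint values of the integrand -/

section MittagLeffler

/-- Keep only `t > M` in Euler's integral. As `M` is free, `Γ` outgrows every geometric sequence. -/
lemma rpow_mul_exp_neg_le_Gamma {M s : ℝ} (hM : 0 < M) (hs : 1 ≤ s) :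
    M ^ (s - 1) * Real.exp (-M) ≤ Real.Gamma s := by
  have hint := Real.GammaIntegral_convergent (s := s) (by linarith)
  rw [Real.Gamma_eq_integral (by linarith), ← integral_exp_neg_Ioi M, ← integral_const_mul]
  calc ∫ t in Ioi M, M ^ (s - 1) * Real.exp (-t)
      ≤ ∫ t in Ioi M, Real.exp (-t) * t ^ (s - 1) := by
        refine setIntegral_mono_on ((integrableOn_exp_neg_Ioi M).const_mul _)
          (hint.mono_set (Ioi_subset_Ioi hM.le)) measurableSet_Ioi fun t ht => ?_
        rw [mul_comm]
        gcongr
        exact ht.le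
    _ ≤ ∫ t in Ioi 0, Real.exp (-t) * t ^ (s - 1) := by
        refine setIntegral_mono_set hint ?_ (Ioi_subset_Ioi hM.le).eventuallyLE
        filter_upwards [ae_restrict_mem measurableSet_Ioi] with t ht
        have : (0 : ℝ) < t := ht
        positivity

lemma summable_mittagLeffler {α y : ℝ} (hα : 0 < α) (hy : 0 < y) :
    Summable fun k : ℕ => y ^ k / Real.Gamma (α * k + 1) := by
  -- Chosen so that `M ^ α = 2 y`, which bounds the terms by `exp M / 2 ^ k`.
  set M : ℝ := (2 * y) ^ (1 / α) with hMdef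
  have hM : 0 < M := by positivity
  have hMα : M ^ α = 2 * y := by
    rw [hMdef, ← Real.rpow_mul (by positivity), one_div_mul_cancel hα.ne', Real.rpow_one]
  have hG : ∀ k : ℕ, 0 < Real.Gamma (α * k + 1) := fun k =>
    Real.Gamma_pos_of_pos (by positivity)
  refine Summable.of_nonneg_of_le (fun k => div_nonneg (by positivity) (hG k).le) (fun k => ?_)
    ((summable_geometric_of_lt_one (r := 1 / 2) (by norm_num) (by norm_num)).mul_left
      (Real.exp M))
  have h := rpow_mul_exp_neg_le_Gamma hM (s := α * k + 1) (by
    have : (0 : ℝ) ≤ α * k := by positivity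
    linarith)
  rw [add_sub_cancel_right, Real.rpow_mul hM.le, hMα, Real.rpow_natCast] at h
  rw [div_le_iff₀ (hG k)]
  calc y ^ k = Real.exp M * (1 / 2) ^ k * ((2 * y) ^ k * Real.exp (-M)) := by
        rw [Real.exp_neg, mul_pow, one_div, inv_pow]
        field_simp
    _ ≤ _ := by gcongr

lemma one_add_le_mittagLeffler {α y : ℝ} (hα : 0 < α) (hy : 0 < y) :
    1 + y / Real.Gamma (α + 1) ≤ mittagLeffler α y := by
  have h := (summable_mittagLeffler hα hy).sum_le_tsum (Finset.range 2) fun k _ =>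
    div_nonneg (by positivity) (Real.Gamma_pos_of_pos (by positivity)).le
  simpa [Finset.sum_range_succ, mittagLeffler] using h

lemma mittagLeffler_zero (α : ℝ) : mittagLeffler α 0 = 1 := by
  rw [mittagLeffler, tsum_eq_single 0 fun k hk => by simp [hk]]
  simp

lemma bddAbove_mittagLeffler_le {α : ℝ} (hα : 0 < α) (u : ℝ) :
    BddAbove {y : ℝ | mittagLeffler α y ≤ u} := by
  refine ⟨max 0 (u * Real.Gamma (α + 1)), fun y hy => ?_⟩
  rcases le_or_gt y 0 with h | h
  · exact le_max_of_le_left h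
  · refine le_max_of_le_right ?_
    have hG : 0 < Real.Gamma (α + 1) := Real.Gamma_pos_of_pos (by positivity)
    have := one_add_le_mittagLeffler hα h
    have hy' : mittagLeffler α y ≤ u := hy
    exact (div_le_iff₀ hG).1 (by linarith)

lemma fracLog_one {α : ℝ} (hα : 0 < α) : fracLog α 1 = 0 := by
  refine le_antisymm (csSup_le ⟨0, (mittagLeffler_zero α).le⟩ fun y hy => ?_)
    (le_csSup (bddAbove_mittagLeffler_le hα 1) (mittagLeffler_zero α).le)
  by_contra! h
  have hG : 0 < Real.Gamma (α + 1) := Real.Gamma_pos_of_pos (by positivity)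
  have := one_add_le_mittagLeffler hα h
  have hy' : mittagLeffler α y ≤ 1 := hy
  have : 0 < y / Real.Gamma (α + 1) := by positivity
  linarith

lemma measurable_fracLog {α : ℝ} (hα : 0 < α) : Measurable (fracLog α) := by
  -- `fracLog α` is monotone only where the supremum is over a nonempty set; elsewhere `sSup ∅ = 0`.
  set s : Set ℝ := {u | {y : ℝ | mittagLeffler α y ≤ u}.Nonempty}
  have hs : MeasurableSet s := by
    refine OrdConnected.measurableSet ⟨fun u hu v _ w hw => ?_⟩
    exact hu.mono fun y (hy : _ ≤ u) => hy.trans hw.1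
  refine measurable_of_restrict_of_restrict_compl hs ?_ ?_
  · refine Monotone.measurable fun u v huv => ?_
    exact csSup_le_csSup (bddAbove_mittagLeffler_le hα _) u.2 fun y (hy : _ ≤ u.1) => hy.trans huv
  · have : sᶜ.domRestrict (fracLog α) = fun _ => 0 := by
      ext u
      have : {y : ℝ | mittagLeffler α y ≤ u} = ∅ := not_nonempty_iff_eq_empty.1 u.2
      simp [domRestrict_apply, fracLog, this]
    rw [this]
    exact measurable_const

lemma measurable_entropyFun {α : ℝ} (hα : 0 < α) : Measurable (entropyFun α) :=
  measurable_id.mul ((measurable_fracLog hα).neg.pow_const _)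

lemma entropyFun_zero (α : ℝ) : entropyFun α 0 = 0 := by simp [entropyFun]

lemma entropyFun_one {α : ℝ} (hα : 0 < α) : entropyFun α 1 = 0 := by
  simp [entropyFun, fracLog_one hα, Real.zero_rpow (inv_ne_zero hα.ne')]

end MittagLeffler

/-! ### Log-concave functions -/

section LogConcave

variable {f : ℝ → ℝ}

/-- Both `a + h` and `s` are convex combinations of `a` and `s + h`, with swapped weights; multiply
the two inequalities. -/
lemma LogConcave.mul_le_mul_of_add (hf : LogConcave f) {a s h : ℝ} (has : a ≤ s) (hh : 0 ≤ h) :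
    f a * f (s + h) ≤ f (a + h) * f s := by
  rcases has.eq_or_lt with rfl | has
  · rw [mul_comm]
  rcases hh.eq_or_lt with rfl | hh
  · simp
  have hd : 0 < s + h - a := by linarith
  have hw : (s - a) / (s + h - a) + h / (s + h - a) = 1 := by field_simp; ring
  have hv : h / (s + h - a) + (s - a) / (s + h - a) = 1 := by rw [add_comm]; exact hw
  have hp : 0 < (s - a) / (s + h - a) := div_pos (by linarith) hd
  have hq : 0 < h / (s + h - a) := div_pos hh hd
  have h1 := hf.2 a (s + h) _ _ hp hq hw
  have h2 := hf.2 a (s + h) _ _ hq hp hv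
  have e1 : (s - a) / (s + h - a) * a + h / (s + h - a) * (s + h) = a + h := by
    field_simp; ring
  have e2 : h / (s + h - a) * a + (s - a) / (s + h - a) * (s + h) = s := by
    field_simp; ring
  rw [e1] at h1
  rw [e2] at h2
  have key : ∀ x, f x ^ ((s - a) / (s + h - a)) * f x ^ (h / (s + h - a)) = f x := fun x => by
    rw [← Real.rpow_add_of_nonneg (hf.1 x) hp.le hq.le, hw, Real.rpow_one]
  calc f a * f (s + h)
      = (f a ^ ((s - a) / (s + h - a)) * f (s + h) ^ (h / (s + h - a))) *
        (f a ^ (h / (s + h - a)) * f (s + h) ^ ((s - a) / (s + h - a))) := by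
        conv_lhs => rw [← key a, ← key (s + h)]
        ring
    _ ≤ f (a + h) * f s := _root_.mul_le_mul h1 h2
        (mul_nonneg (Real.rpow_nonneg (hf.1 _) _) (Real.rpow_nonneg (hf.1 _) _)) (hf.1 _)

lemma LogConcave.pos_of_le_of_le (hf : LogConcave f) {s a t : ℝ} (hsa : s ≤ a) (hat : a ≤ t)
    (hs : 0 < f s) (ht : 0 < f t) : 0 < f a := by
  have h := hf.mul_le_mul_of_add (a := s) (s := a) (h := t - a) hsa (by linarith)
  rw [add_sub_cancel] at h
  exact pos_of_mul_pos_right ((mul_pos hs ht).trans_le h) (hf.1 _)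

end LogConcave

/-! ### Distribution functions with log-concave density -/

section Cdf

variable {f : ℝ → ℝ} {μ : Measure ℝ} [IsProbabilityMeasure μ]

lemma integrable_density (hfm : Measurable f) (hf : LogConcave f)
    (hμ : μ = volume.withDensity fun x => ENNReal.ofReal (f x)) : Integrable f := by
  refine ⟨hfm.aestronglyMeasurable, ?_⟩
  rw [hasFiniteIntegral_iff_ofReal (ae_of_all _ hf.1)]
  have h : μ univ = ∫⁻ x, ENNReal.ofReal (f x) := by
    rw [hμ, withDensity_apply _ MeasurableSet.univ, Measure.restrict_univ]
  rw [← h]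
  exact measure_lt_top _ _

lemma cdf_eq_setIntegral (hfm : Measurable f) (hf : LogConcave f)
    (hμ : μ = volume.withDensity fun x => ENNReal.ofReal (f x)) (x : ℝ) :
    cdf μ x = ∫ t in Iic x, f t := by
  rw [cdf_eq_real, Measure.real, integral_eq_lintegral_of_nonneg_ae (ae_of_all _ hf.1)
    hfm.aestronglyMeasurable]
  congr 1
  rw [hμ, withDensity_apply _ measurableSet_Iic]

lemma cdf_sub_cdf (hfm : Measurable f) (hf : LogConcave f)
    (hμ : μ = volume.withDensity fun x => ENNReal.ofReal (f x)) (x y : ℝ) :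
    cdf μ y - cdf μ x = ∫ t in x..y, f t := by
  have hi := integrable_density hfm hf hμ
  rw [cdf_eq_setIntegral hfm hf hμ, cdf_eq_setIntegral hfm hf hμ,
    intervalIntegral.integral_Iic_sub_Iic hi.integrableOn hi.integrableOn]

lemma continuous_cdf (hfm : Measurable f) (hf : LogConcave f)
    (hμ : μ = volume.withDensity fun x => ENNReal.ofReal (f x)) : Continuous (cdf μ) := by
  have hi := integrable_density hfm hf hμ
  have h : (cdf μ : ℝ → ℝ) = fun y => cdf μ 0 + ∫ t in (0 : ℝ)..y, f t := by
    ext y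
    rw [← cdf_sub_cdf hfm hf hμ]
    ring
  rw [h]
  exact continuous_const.add (intervalIntegral.continuous_primitive
    (fun a b => hi.intervalIntegrable) 0)

/-- Supporting line inequality for the concave function `p ↦ F (F⁻¹ p + h)`. -/
lemma mul_cdf_sub_le (hfm : Measurable f) (hf : LogConcave f)
    (hμ : μ = volume.withDensity fun x => ENNReal.ofReal (f x)) (a t : ℝ) {h : ℝ} (hh : 0 ≤ h) :
    f a * (cdf μ (t + h) - cdf μ (a + h)) ≤ f (a + h) * (cdf μ t - cdf μ a) := by
  have hi := integrable_density hfm hf hμ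
  have hih : Integrable fun s => f (s + h) := hi.comp_add_right h
  rw [cdf_sub_cdf hfm hf hμ, cdf_sub_cdf hfm hf hμ,
    ← intervalIntegral.integral_comp_add_right (fun s => f s) h,
    ← intervalIntegral.integral_const_mul, ← intervalIntegral.integral_const_mul]
  -- For `t ≤ a` the pointwise inequality flips, and so does the orientation of the integrals.
  rcases le_total a t with hat | hat
  · exact intervalIntegral.integral_mono_on hat (hih.const_mul _).intervalIntegrable
      (hi.const_mul _).intervalIntegrable fun s hs => hf.mul_le_mul_of_add hs.1 hh
  · rw [intervalIntegral.integral_symm t a, intervalIntegral.integral_symm t a, neg_le_neg_iff]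
    refine intervalIntegral.integral_mono_on hat (hi.const_mul _).intervalIntegrable
      (hih.const_mul _).intervalIntegrable fun s hs => ?_
    have := hf.mul_le_mul_of_add hs.2 hh
    linarith

/-- There is mass on both sides of `a`, and the positivity set of `f` is an interval. -/
lemma density_pos_of_cdf_mem_Ioo (hfm : Measurable f) (hf : LogConcave f)
    (hμ : μ = volume.withDensity fun x => ENNReal.ofReal (f x)) {a : ℝ}
    (ha : cdf μ a ∈ Ioo (0 : ℝ) 1) : 0 < f a := by
  have hi := integrable_density hfm hf hμ
  have hone : ∫ t, f t = 1 := by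
    have h : μ univ = ∫⁻ x, ENNReal.ofReal (f x) := by
      rw [hμ, withDensity_apply _ MeasurableSet.univ, Measure.restrict_univ]
    rw [integral_eq_lintegral_of_nonneg_ae (ae_of_all _ hf.1) hfm.aestronglyMeasurable, ← h]
    simp
  have hsplit : ∫ t in Ioi a, f t = 1 - cdf μ a := by
    rw [cdf_eq_setIntegral hfm hf hμ, ← hone,
      ← intervalIntegral.integral_Iic_add_Ioi (b := a) hi.integrableOn hi.integrableOn]
    ring
  obtain ⟨s, hs, hfs⟩ : ∃ s ≤ a, 0 < f s := by
    by_contra! hc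
    have := setIntegral_nonpos (μ := volume) (f := f) (measurableSet_Iic (a := a)) hc
    rw [← cdf_eq_setIntegral hfm hf hμ] at this
    exact absurd ha.1 this.not_gt
  obtain ⟨t, ht, hft⟩ : ∃ t > a, 0 < f t := by
    by_contra! hc
    have := setIntegral_nonpos (μ := volume) (f := f) (measurableSet_Ioi (a := a)) hc
    linarith [ha.2]
  exact hf.pos_of_le_of_le hs (le_of_lt ht) hfs hft

/-- A flat piece at a level in `(0, 1)` would carry positive density. -/
lemma le_of_cdf_le (hfm : Measurable f) (hf : LogConcave f)
    (hμ : μ = volume.withDensity fun x => ENNReal.ofReal (f x)) {a b : ℝ}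
    (hb : cdf μ b ∈ Ioo (0 : ℝ) 1) (hba : cdf μ b ≤ cdf μ a) : b ≤ a := by
  by_contra! hab
  have hi := integrable_density hfm hf hμ
  have heq : cdf μ a = cdf μ b := le_antisymm (monotone_cdf μ hab.le) hba
  have hpos : ∀ t ∈ Ioo a b, 0 < f t := fun t ht => by
    refine density_pos_of_cdf_mem_Ioo hfm hf hμ ⟨?_, ?_⟩
    · exact (heq ▸ hb.1).trans_le (monotone_cdf μ ht.1.le)
    · exact (monotone_cdf μ ht.2.le).trans_lt hb.2
  have := intervalIntegral.intervalIntegral_pos_of_pos_on hi.intervalIntegrable hpos hab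
  rw [← cdf_sub_cdf hfm hf hμ] at this
  linarith

end Cdf

/-! ### Convolution and the dispersive order -/

section Conv

variable {μ ν : Measure ℝ} [IsProbabilityMeasure μ] [IsProbabilityMeasure ν]

lemma integrable_cdf_sub {μ ν : Measure ℝ} [IsProbabilityMeasure ν] (z : ℝ) :
    Integrable (fun y => cdf μ (z - y)) ν := by
  refine Integrable.of_bound
    ((monotone_cdf μ).measurable.comp (measurable_const.sub measurable_id)).aestronglyMeasurable 1
    (ae_of_all _ fun y => ?_)
  rw [Real.norm_of_nonneg (cdf_nonneg μ _)]
  exact cdf_le_one μ _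

lemma cdf_conv (z : ℝ) : cdf (μ.conv ν) z = ∫ y, cdf μ (z - y) ∂ν := by
  rw [cdf_eq_real, Measure.real, integral_eq_lintegral_of_nonneg_ae
    (ae_of_all _ fun y => cdf_nonneg μ _) (integrable_cdf_sub z).aestronglyMeasurable,
    Measure.conv_comm]
  congr 1
  rw [Measure.conv, Measure.map_apply (by fun_prop) measurableSet_Iic,
    Measure.prod_apply (measurableSet_Iic.preimage (by fun_prop))]
  refine lintegral_congr fun y => ?_
  rw [cdf_eq_real, ofReal_measureReal]
  congr 1
  ext x
  simp [le_sub_iff_add_le, add_comm]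

lemma continuous_cdf_conv (hF : Continuous (cdf μ)) : Continuous (cdf (μ.conv ν)) := by
  have h : (cdf (μ.conv ν) : ℝ → ℝ) = fun z => ∫ y, cdf μ (z - y) ∂ν := funext cdf_conv
  rw [h]
  refine continuous_of_dominated (bound := fun _ => 1)
    (fun z => (integrable_cdf_sub z).aestronglyMeasurable)
    (fun z => ae_of_all _ fun y => ?_) (integrable_const _)
    (ae_of_all _ fun y => hF.comp (continuous_id.sub continuous_const))
  rw [Real.norm_of_nonneg (cdf_nonneg μ _)]
  exact cdf_le_one μ _

lemma exists_cdf_eq {ρ : Measure ℝ} (hF : Continuous (cdf ρ)) {p : ℝ} (hp : p ∈ Ioo (0 : ℝ) 1) :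
    ∃ x, cdf ρ x = p := by
  obtain ⟨a, ha⟩ := ((tendsto_cdf_atBot ρ).eventually_lt_const hp.1).exists
  obtain ⟨b, hb⟩ := ((tendsto_cdf_atTop ρ).eventually_const_lt hp.2).exists
  exact mem_range_of_exists_le_of_exists_ge hF ⟨a, ha.le⟩ ⟨b, hb.le⟩

variable {f : ℝ → ℝ}

/-- Convolution with an arbitrary law increases a law with log-concave density in the dispersive
order. -/
lemma cdf_conv_add_le (hfm : Measurable f) (hf : LogConcave f)
    (hμ : μ = volume.withDensity fun x => ENNReal.ofReal (f x)) {a x h : ℝ} (hh : 0 ≤ h)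
    (ha : cdf μ a ∈ Ioo (0 : ℝ) 1) (hax : cdf μ a = cdf (μ.conv ν) x) :
    cdf (μ.conv ν) (x + h) ≤ cdf μ (a + h) := by
  have hpos := density_pos_of_cdf_mem_Ioo hfm hf hμ ha
  -- Average the supporting line at `a` over `t = x - y`; by `hax` the right side integrates to
  -- zero.
  have hle : ∫ y, f a * (cdf μ (x + h - y) - cdf μ (a + h)) ∂ν ≤
      ∫ y, f (a + h) * (cdf μ (x - y) - cdf μ a) ∂ν := by
    refine integral_mono (((integrable_cdf_sub _).sub (integrable_const _)).const_mul _)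
      (((integrable_cdf_sub _).sub (integrable_const _)).const_mul _) fun y => ?_
    have := mul_cdf_sub_le hfm hf hμ a (x - y) hh
    rwa [show x - y + h = x + h - y by ring] at this
  rw [integral_const_mul, integral_const_mul,
    integral_sub (integrable_cdf_sub _) (integrable_const _),
    integral_sub (integrable_cdf_sub _) (integrable_const _), ← cdf_conv, ← cdf_conv, ← hax] at hle
  simp only [integral_const, probReal_univ, one_smul, sub_self, mul_zero] at hle
  linarith [nonpos_of_mul_nonpos_right hle hpos]

lemma volume_preimage_cdf_le (hfm : Measurable f) (hf : LogConcave f)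
    (hμ : μ = volume.withDensity fun x => ENNReal.ofReal (f x)) {A : Set ℝ}
    (hA : A ⊆ Ioo 0 1) :
    volume (cdf μ ⁻¹' A) ≤ volume (cdf (μ.conv ν) ⁻¹' A) := by
  have hF := continuous_cdf hfm hf hμ
  -- `ψ` plays the role of `F⁻¹ ∘ G`; its value off levels in `(0, 1)` is irrelevant.
  have hex : ∀ x, ∃ a, cdf (μ.conv ν) x ∈ Ioo (0 : ℝ) 1 → cdf μ a = cdf (μ.conv ν) x := fun x => by
    by_cases hx : cdf (μ.conv ν) x ∈ Ioo (0 : ℝ) 1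
    · exact (exists_cdf_eq hF hx).imp fun _ h _ => h
    · exact ⟨0, fun h => absurd h hx⟩
  choose ψ hψ using hex
  have hlip : LipschitzOnWith 1 ψ (cdf (μ.conv ν) ⁻¹' A) := by
    have aux : ∀ x ∈ cdf (μ.conv ν) ⁻¹' A, ∀ y ∈ cdf (μ.conv ν) ⁻¹' A, x ≤ y →
        dist (ψ x) (ψ y) ≤ dist x y := by
      intro x hx y hy hxy
      have ex := hψ x (hA hx)
      have ey := hψ y (hA hy)
      have hx' : cdf μ (ψ x) ∈ Ioo (0 : ℝ) 1 := ex ▸ hA hx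
      have hy' : cdf μ (ψ y) ∈ Ioo (0 : ℝ) 1 := ey ▸ hA hy
      have h1 : ψ x ≤ ψ y := le_of_cdf_le hfm hf hμ hx' <| by
        rw [ex, ey]
        exact monotone_cdf _ hxy
      have h2 : ψ y ≤ ψ x + (y - x) := le_of_cdf_le hfm hf hμ hy' <| by
        have := cdf_conv_add_le hfm hf hμ (sub_nonneg.2 hxy) hx' ex
        rwa [add_sub_cancel, ← ey] at this
      rw [dist_comm, dist_comm x, Real.dist_eq, Real.dist_eq, abs_of_nonneg (by linarith),
        abs_of_nonneg (by linarith)]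
      linarith
    refine LipschitzOnWith.of_dist_le_mul fun x hx y hy => ?_
    rw [NNReal.coe_one, one_mul]
    rcases le_total x y with h | h
    · exact aux x hx y hy h
    · rw [dist_comm, dist_comm x]
      exact aux y hy x hx h
  have hsub : cdf μ ⁻¹' A ⊆ ψ '' (cdf (μ.conv ν) ⁻¹' A) := by
    intro b hb
    obtain ⟨x, hx⟩ := exists_cdf_eq (continuous_cdf_conv (ν := ν) hF) (hA hb)
    have hxA : cdf (μ.conv ν) x ∈ A := hx ▸ hb
    have e : cdf μ (ψ x) = cdf μ b := (hψ x (hA hxA)).trans hx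
    exact ⟨x, hxA, le_antisymm (le_of_cdf_le hfm hf hμ (e ▸ hA hb) e.le)
      (le_of_cdf_le hfm hf hμ (hA hb) e.ge)⟩
  refine (measure_mono hsub).trans ?_
  -- On the line, Lebesgue measure is one-dimensional Hausdorff measure, which 1-Lipschitz maps do
  -- not increase.
  have := hlip.hausdorffMeasure_image_le (d := 1) zero_le_one
  simpa [hausdorffMeasure_real] using this

lemma lintegral_comp_cdf_le (hfm : Measurable f) (hf : LogConcave f)
    (hμ : μ = volume.withDensity fun x => ENNReal.ofReal (f x)) {g : ℝ → ENNReal}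
    (hg : Measurable g) (hg0 : g 0 = 0) (hg1 : g 1 = 0) :
    ∫⁻ x, g (cdf μ x) ≤ ∫⁻ x, g (cdf (μ.conv ν) x) := by
  -- Levels 0 and 1 may be taken on sets of infinite measure; there `g` vanishes.
  have key : ∀ ρ : Measure ℝ, ∫⁻ x, g (cdf ρ x) =
      ∫⁻ u, g u ∂((volume.map (cdf ρ)).restrict (Ioo 0 1)) := fun ρ => by
    rw [← lintegral_indicator measurableSet_Ioo,
      lintegral_map (hg.indicator measurableSet_Ioo) (monotone_cdf ρ).measurable]
    refine lintegral_congr fun x => ?_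
    by_cases hx : cdf ρ x ∈ Ioo (0 : ℝ) 1
    · rw [indicator_of_mem hx]
    · rw [indicator_of_notMem hx]
      rcases (cdf_nonneg ρ x).eq_or_lt with h0 | h0
      · rw [← h0, hg0]
      · rcases (cdf_le_one ρ x).eq_or_lt with h1 | h1
        · rw [h1, hg1]
        · exact absurd ⟨h0, h1⟩ hx
  rw [key, key]
  refine lintegral_mono' (Measure.le_iff.2 fun s hs => ?_) le_rfl
  rw [Measure.restrict_apply hs, Measure.restrict_apply hs,
    Measure.map_apply (monotone_cdf _).measurable (hs.inter measurableSet_Ioo),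
    Measure.map_apply (monotone_cdf _).measurable (hs.inter measurableSet_Ioo)]
  exact volume_preimage_cdf_le hfm hf hμ inter_subset_right

end Conv

/-! ### Entropies of a sum -/

section RandomVariables

variable {Ω : Type*} [MeasurableSpace Ω] {P : Measure Ω} [IsProbabilityMeasure P] {X Y : Ω → ℝ}

lemma cdf_map_eq_zero_of_neg (hX : Measurable X) (hX0 : ∀ᵐ ω ∂P, 0 ≤ X ω) {x : ℝ} (hx : x < 0) :
    cdf (P.map X) x = 0 := by
  have := Measure.isProbabilityMeasure_map (μ := P) hX.aemeasurable
  rw [cdf_eq_real, map_measureReal_apply hX measurableSet_Iic, Measure.real]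
  have : P (X ⁻¹' Iic x) = 0 := by
    refine measure_mono_null (fun ω hω => ?_) hX0
    have hω' : X ω ≤ x := hω
    exact not_le.2 (hω'.trans_lt hx)
  rw [this, ENNReal.toReal_zero]

lemma setLIntegral_comp_cdf_le (hX : Measurable X) (hY : Measurable Y)
    (hX0 : ∀ᵐ ω ∂P, 0 ≤ X ω) (hY0 : ∀ᵐ ω ∂P, 0 ≤ Y ω) (hXY : IndepFun X Y P)
    (hXf : HasLogConcaveDensity X P) {g : ℝ → ENNReal}
    (hg : Measurable g) (hg0 : g 0 = 0) (hg1 : g 1 = 0) :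
    ∫⁻ x in Ioi (0 : ℝ), g (cdf (P.map X) x) ≤ ∫⁻ x in Ioi (0 : ℝ), g (cdf (P.map (X + Y)) x) := by
  have := Measure.isProbabilityMeasure_map (μ := P) hX.aemeasurable
  have := Measure.isProbabilityMeasure_map (μ := P) hY.aemeasurable
  obtain ⟨f, hfm, hf, hμ⟩ := hXf
  have hZ0 : ∀ᵐ ω ∂P, 0 ≤ (X + Y) ω := by
    filter_upwards [hX0, hY0] with ω h1 h2 using add_nonneg h1 h2
  calc ∫⁻ x in Ioi (0 : ℝ), g (cdf (P.map X) x)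
      ≤ ∫⁻ x, g (cdf (P.map X) x) := setLIntegral_le_lintegral _ _
    _ ≤ ∫⁻ x, g (cdf (P.map (X + Y)) x) := by
        rw [hXY.map_add_eq_map_conv_map hX hY]
        exact lintegral_comp_cdf_le hfm hf hμ hg hg0 hg1
    _ = ∫⁻ x in Ici (0 : ℝ), g (cdf (P.map (X + Y)) x) := by
        refine (setLIntegral_eq_of_support_subset fun x hx => ?_).symm
        by_contra h
        exact hx (by simp [cdf_map_eq_zero_of_neg (hX.add hY) hZ0 (not_le.1 h), hg0])
    _ = ∫⁻ x in Ioi (0 : ℝ), g (cdf (P.map (X + Y)) x) :=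
        setLIntegral_congr Ioi_ae_eq_Ici.symm

lemma efcpe_le_efcpe_add {α : ℝ} (hα : 0 < α) (hX : Measurable X) (hY : Measurable Y)
    (hX0 : ∀ᵐ ω ∂P, 0 ≤ X ω) (hY0 : ∀ᵐ ω ∂P, 0 ≤ Y ω) (hXY : IndepFun X Y P)
    (hXf : HasLogConcaveDensity X P) : efcpe α X P ≤ efcpe α (X + Y) P :=
  setLIntegral_comp_cdf_le hX hY hX0 hY0 hXY hXf
    (g := fun u => ENNReal.ofReal (entropyFun α u)) (measurable_entropyFun hα).ennreal_ofReal
    (by simp [entropyFun_zero]) (by simp [entropyFun_one hα])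

lemma efcre_le_efcre_add {α : ℝ} (hα : 0 < α) (hX : Measurable X) (hY : Measurable Y)
    (hX0 : ∀ᵐ ω ∂P, 0 ≤ X ω) (hY0 : ∀ᵐ ω ∂P, 0 ≤ Y ω) (hXY : IndepFun X Y P)
    (hXf : HasLogConcaveDensity X P) : efcre α X P ≤ efcre α (X + Y) P :=
  setLIntegral_comp_cdf_le hX hY hX0 hY0 hXY hXf
    (g := fun u => ENNReal.ofReal (entropyFun α (1 - u)))
    ((measurable_entropyFun hα).comp (measurable_const.sub measurable_id)).ennreal_ofReal
    (by simp [entropyFun_one hα]) (by simp [entropyFun_zero])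

lemma pairedEntropy_le_pairedEntropy_add {α : ℝ} (hα : 0 < α) (hX : Measurable X)
    (hY : Measurable Y) (hX0 : ∀ᵐ ω ∂P, 0 ≤ X ω) (hY0 : ∀ᵐ ω ∂P, 0 ≤ Y ω) (hXY : IndepFun X Y P)
    (hXf : HasLogConcaveDensity X P) : pairedEntropy α X P ≤ pairedEntropy α (X + Y) P :=
  add_le_add (efcre_le_efcre_add hα hX hY hX0 hY0 hXY hXf)
    (efcpe_le_efcpe_add hα hX hY hX0 hY0 hXY hXf)

end RandomVariables

end FracEntropy

theorem proposition2p8 {Ω : Type*} [MeasurableSpace Ω] (P : Measure Ω) [IsProbabilityMeasure P]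
    (α : ℝ) (hα0 : 0 < α) (hα1 : α < 1) (X Y : Ω → ℝ)
    (hX : Measurable X) (hY : Measurable Y)
    (hX0 : ∀ᵐ ω ∂P, 0 ≤ X ω) (hY0 : ∀ᵐ ω ∂P, 0 ≤ Y ω)
    (hXY : IndepFun X Y P)
    (hXf : FracEntropy.HasLogConcaveDensity X P) (hYf : FracEntropy.HasLogConcaveDensity Y P) :
    max (FracEntropy.efcpe α X P) (FracEntropy.efcpe α Y P) ≤ FracEntropy.efcpe α (X + Y) P ∧
      max (FracEntropy.pairedEntropy α X P) (FracEntropy.pairedEntropy α Y P) ≤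
        FracEntropy.pairedEntropy α (X + Y) P := by
  refine ⟨max_le (FracEntropy.efcpe_le_efcpe_add hα0 hX hY hX0 hY0 hXY hXf) ?_,
    max_le (FracEntropy.pairedEntropy_le_pairedEntropy_add hα0 hX hY hX0 hY0 hXY hXf) ?_⟩
  -- Only one summand's log-concavity is used per bound, so the roles can be swapped.
  · rw [add_comm]
    exact FracEntropy.efcpe_le_efcpe_add hα0 hY hX hY0 hX0 hXY.symm hYf
  · rw [add_comm]
    exact FracEntropy.pairedEntropy_le_pairedEntropy_add hα0 hY hX hY0 hX0 hXY.symm hYf
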